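/- Let $N\ge 0$ and let $\mathbb{H}^N\cong\mathbb{C}^N\times\mathbb{C}^N\ni(z,w)$ be acted on by the torus $T^N=\{\zeta\in\mathbb{C}^N : |\zeta_i|=1\}$ via $(z,w)\zeta=(z\zeta,w\zeta^{-1})$. Let $K\subseteq T^N$ be a connected subtorus (a closed connected subgroup) with Lie algebra $\iota\colon k\hookrightarrow t^N=\mathbb{R}^N$, let $u_1,\dots,u_N$ be the coordinate functions on $t^N$, and let $k^*_{\mathbb{C}}=k^*\otimes\mathbb{C}$. Let $\mu=(\mu_1,\mu_{\mathbb{C}})\colon\mathbb{H}^N\to k^*\times k^*_{\mathbb{C}}$ be the hyperkähler moment map $$\mu_1(z,w)=\pi\sum_{i=1}^N(|z_i|^2-|w_i|^2)\,\iota^*u_i,\qquad \mu_{\mathbb{C}}(z,w)=-2\pi\sqrt{-1}\sum_{i=1}^N z_iw_i\,\iota^*u_i,$$ and let $(k^*\times k^*_{\mathbb{C}})_{reg}$ be its set of regular values. Put $X(\alpha,\beta)=\mu^{-1}(\alpha,\beta)/K$ and $L(\alpha)=\mu_1^{-1}(\alpha)/K$. Suppose $(\alpha,0)\in(k^*\times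 k^*_{\mathbb{C}})_{reg}$. Then $L(\alpha)$ is diffeomorphic to the product $X(\alpha,0)\times k^*_{\mathbb{C}}$. In particular, $X(\alpha,0)$ is homotopy equivalent to $L(\alpha)$. Here $L(\alpha)$ and $X(\alpha,0)\times k^*_{\mathbb{C}}=(\mu^{-1}(\alpha,0)\times k^*_{\mathbb{C}})/K$ are orbifolds, quotients of submanifolds by locally free $K$-actions, and a diffeomorphism is a homeomorphism of the quotients which, like its inverse, lifts near each point to a smooth map between those submanifolds. -/

import Mathlib

open scoped ContDiff Topology

namespace ToricHK

/-- The quaternionic vector space `ℍ^N`, identified with `ℂ^N × ℂ^N` by `ξ = z + w I₂`.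
Only its structure as a finite-dimensional real vector space matters for smoothness. -/
abbrev HN (N : ℕ) : Type := (Fin N → ℂ) × (Fin N → ℂ)

/-- The real torus `T^N`. -/
abbrev Torus (N : ℕ) : Type := Fin N → Circle

/-- The action `(z, w) ζ = (z ζ, w ζ⁻¹)` of `T^N` on `ℍ^N` (the torus is commutative, so left and
right actions are the same thing). -/
noncomputable def act {N : ℕ} (ζ : Torus N) (p : HN N) : HN N :=
  (fun i => (ζ i : ℂ) * p.1 i, fun i => ((ζ i)⁻¹ : Circle) * p.2 i)

theorem act_one {N : ℕ} (p : HN N) : act 1 p = p := by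
  ext i <;> simp [act]

theorem act_mul {N : ℕ} (ζ η : Torus N) (p : HN N) : act (ζ * η) p = act ζ (act η p) := by
  ext i <;> simp [act] <;> ring

/-- The exponential map `t^N → T^N`, normalised so that its kernel is the lattice `ℤ^N`. -/
noncomputable def torusExp {N : ℕ} (x : Fin N → ℝ) : Torus N :=
  fun i => Circle.exp (2 * Real.pi * x i)

theorem torusExp_zero {N : ℕ} : torusExp (0 : Fin N → ℝ) = 1 := by
  ext i; simp [torusExp]

theorem torusExp_add {N : ℕ} (x y : Fin N → ℝ) :
    torusExp (x + y) = torusExp x * torusExp y := by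
  funext i; simp [torusExp, mul_add, Circle.exp_add]

/-- The Lie algebra `k ⊆ t^N = ℝ^N` of a closed subgroup `K ⊆ T^N`: the generators of the
one-parameter subgroups that lie in `K`. -/
noncomputable def lieAlg {N : ℕ} (K : Subgroup (Torus N)) : Submodule ℝ (Fin N → ℝ) where
  carrier := {x | ∀ t : ℝ, torusExp (t • x) ∈ K}
  zero_mem' := by
    intro t
    rw [smul_zero, torusExp_zero]
    exact K.one_mem
  add_mem' := by
    intro x y hx hy t
    rw [smul_add, torusExp_add]
    exact K.mul_mem (hx t) (hy t)
  smul_mem' := by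
    intro c x hx t
    rw [smul_smul]
    exact hx (t * c)

/-- The Lie algebra `k` as a type, with the norm and vector space structure induced from `ℝ^N`. -/
def Lie {N : ℕ} (K : Subgroup (Torus N)) : Type := ↥(lieAlg K)

noncomputable instance {N : ℕ} (K : Subgroup (Torus N)) : NormedAddCommGroup (Lie K) :=
  inferInstanceAs (NormedAddCommGroup ↥(lieAlg K))

noncomputable instance {N : ℕ} (K : Subgroup (Torus N)) : NormedSpace ℝ (Lie K) :=
  inferInstanceAs (NormedSpace ℝ ↥(lieAlg K))

instance {N : ℕ} (K : Subgroup (Torus N)) : FiniteDimensional ℝ (Lie K) :=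
  inferInstanceAs (FiniteDimensional ℝ ↥(lieAlg K))

/-- The inclusion `ι : k → t^N = ℝ^N`. -/
noncomputable def iota {N : ℕ} (K : Subgroup (Torus N)) : Lie K →L[ℝ] (Fin N → ℝ) :=
  (lieAlg K).subtypeL

/-- The dual space `k^*`. -/
abbrev kDual {N : ℕ} (K : Subgroup (Torus N)) : Type := Lie K →L[ℝ] ℝ

/-- The complexified dual space `k_ℂ^* = k^* ⊗ ℂ`, as the space of real-linear maps `k → ℂ`. -/
abbrev kDualC {N : ℕ} (K : Subgroup (Torus N)) : Type := Lie K →L[ℝ] ℂ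

/-- `ι^* u_i ∈ k^*`, where `u_i` is the `i`-th coordinate on `t^N = ℝ^N`. -/
noncomputable def iotaU {N : ℕ} (K : Subgroup (Torus N)) (i : Fin N) : kDual K :=
  (ContinuousLinearMap.proj (R := ℝ) (φ := fun _ : Fin N => ℝ) i).comp (iota K)

/-- `μ₁(z, w) = π ∑ (|z_i|² - |w_i|²) ι^* u_i`. -/
noncomputable def mu1 {N : ℕ} (K : Subgroup (Torus N)) (p : HN N) : kDual K :=
  Real.pi • ∑ i, (‖p.1 i‖ ^ 2 - ‖p.2 i‖ ^ 2) • iotaU K i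

/-- `μ_ℂ(z, w) = -2 π √-1 ∑ z_i w_i ι^* u_i`. Here `u.smulRight c`, the map `x ↦ u(x) c`, is the
multiple `c u ∈ k_ℂ^*` of `u ∈ k^*` by the complex number `c`. -/
noncomputable def muC {N : ℕ} (K : Subgroup (Torus N)) (p : HN N) : kDualC K :=
  ∑ i, (iotaU K i).smulRight (-2 * (Real.pi : ℂ) * Complex.I * (p.1 i * p.2 i))

/-- The hyperkähler moment map `μ = (μ₁, μ_ℂ) : ℍ^N → k^* × k_ℂ^*`. -/
noncomputable def mu {N : ℕ} (K : Subgroup (Torus N)) (p : HN N) : kDual K × kDualC K :=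
  (mu1 K p, muC K p)

/-- `(k^* × k_ℂ^*)_reg`, the set of regular values of the (polynomial) map `μ`. -/
def regularValues {N : ℕ} (K : Subgroup (Torus N)) : Set (kDual K × kDualC K) :=
  {c | ∀ p : HN N, mu K p = c → Function.Surjective (fderiv ℝ (mu K) p)}

/-- The orbit equivalence relation of `K` on a subset of `ℍ^N`. -/
def orbitSetoid {N : ℕ} (K : Subgroup (Torus N)) (S : Set (HN N)) : Setoid S where
  r p q := ∃ ζ ∈ K, act ζ (p : HN N) = q
  iseqv :=
    { refl := fun p => ⟨1, K.one_mem, act_one _⟩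
      symm := by
        rintro p q ⟨ζ, hζ, h⟩
        refine ⟨ζ⁻¹, K.inv_mem hζ, ?_⟩
        rw [← h, ← act_mul, inv_mul_cancel, act_one]
      trans := by
        rintro p q r ⟨ζ, hζ, h⟩ ⟨η, hη, h'⟩
        refine ⟨η * ζ, K.mul_mem hη hζ, ?_⟩
        rw [act_mul, h, h'] }

/-- The level set `μ⁻¹(α, β) ⊆ ℍ^N`. -/
def hkLevel {N : ℕ} (K : Subgroup (Torus N)) (α : kDual K) (β : kDualC K) : Set (HN N) :=
  {p | mu K p = (α, β)}

/-- The level set `μ₁⁻¹(α) ⊆ ℍ^N`. -/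
def mu1Level {N : ℕ} (K : Subgroup (Torus N)) (α : kDual K) : Set (HN N) :=
  {p | mu1 K p = α}

/-- The toric hyperkähler variety `X(α, β) = μ⁻¹(α, β) / K`, with the quotient topology. -/
abbrev X {N : ℕ} (K : Subgroup (Torus N)) (α : kDual K) (β : kDualC K) : Type :=
  Quotient (orbitSetoid K (hkLevel K α β))

/-- The toric variety `L(α) = μ₁⁻¹(α) / K`, with the quotient topology. -/
abbrev L {N : ℕ} (K : Subgroup (Torus N)) (α : kDual K) : Type :=
  Quotient (orbitSetoid K (mu1Level K α))

/-- The projection `μ₁⁻¹(α) → L(α)`. -/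
def projL {N : ℕ} (K : Subgroup (Torus N)) (α : kDual K) : mu1Level K α → L K α :=
  Quotient.mk _

/-- The projection `μ⁻¹(α, β) × k_ℂ^* → X(α, β) × k_ℂ^*`, presenting the product of the orbifold
`X(α, β)` and the vector space `k_ℂ^*` as the quotient of `μ⁻¹(α, β) × k_ℂ^*` by `K`. -/
def projXV {N : ℕ} (K : Subgroup (Torus N)) (α : kDual K) (β : kDualC K) :
    (hkLevel K α β ×ˢ (Set.univ : Set (kDualC K)) : Set (HN N × kDualC K)) →
      X K α β × kDualC K :=
  fun x => (Quotient.mk _ ⟨x.1.1, x.2.1⟩, x.1.2)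

/-- Let `X` and `Y` be orbifolds presented as quotients `a : A → X`, `b : B → Y` of submanifolds
`A ⊆ E`, `B ⊆ F` by locally free actions of a torus. A map `f : X → Y` is smooth if around every
point it lifts to a smooth map `A → B`; smoothness on the submanifold `A` means having local
smooth extensions to open subsets of `E`. (Slices for the actions are orbifold charts, and local
lifts between neighbourhoods in `A` and `B` are the same as local lifts between slices.) -/
def OrbifoldSmooth {E F : Type*} [NormedAddCommGroup E] [NormedSpace ℝ E]
    [NormedAddCommGroup F] [NormedSpace ℝ F] {A : Set E} {B : Set F} {X Y : Type*}
    (a : A → X) (b : B → Y) (f : X → Y) : Prop :=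
  ∀ p : A, ∃ U : Set E, IsOpen U ∧ (p : E) ∈ U ∧ ∃ s : E → F, ContDiffOn ℝ ∞ s U ∧
    ∀ x : A, (x : E) ∈ U → ∃ h : s x ∈ B, b ⟨s x, h⟩ = f (a x)

/-- Orbifolds presented as quotients are diffeomorphic if there is a homeomorphism between them
that is smooth in both directions. -/
def OrbifoldDiffeomorphic {E F : Type*} [NormedAddCommGroup E] [NormedSpace ℝ E]
    [NormedAddCommGroup F] [NormedSpace ℝ F] {A : Set E} {B : Set F} {X Y : Type*}
    [TopologicalSpace X] [TopologicalSpace Y] (a : A → X) (b : B → Y) : Prop :=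
  ∃ Φ : X ≃ₜ Y, OrbifoldSmooth a b Φ ∧ OrbifoldSmooth b a Φ.symm

end ToricHK

/-!
The real moment map `μ₁` only depends on the numbers `d_i = |z_i|² - |w_i|²`, and the complex one
only on the products `c_i = z_i w_i`. As long as `d_i ≠ 0`, the product `c_i` can be changed at will
with `d_i` fixed, smoothly and equivariantly. Regularity of `(α, 0)`, applied at points with all
`c_i = 0`, says that on `μ₁⁻¹(α)` the forms `ι^* u_i` with `d_i ≠ 0` span `k^*`; hence `μ_ℂ` can be
given any value `β` by changing only those `c_i`. To do this canonically and smoothly, let the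
change of the `c_i` be a combination of the dual frame of the `ι^* u_i` for weights which are
functions of the `d_i` and vanish near `d_i = 0`. As the frame is then the same for all values of
`β`, moving from `μ_ℂ⁻¹(β)` to `μ_ℂ⁻¹(γ)` and back gives the identity, and `μ₁⁻¹(α)` becomes the
product of `μ⁻¹(α, β)` and `k_ℂ^*`, compatibly with the action.
-/

namespace ToricHK

section SmallCoefficients

variable {ι E : Type*} [Fintype ι] [NormedAddCommGroup E] [NormedSpace ℝ E]

theorem eventually_forall_sub_sum_smul_mem_span (v : ι → E) (α : E) :
    ∀ᶠ e : ι → ℝ in 𝓝 0, ∀ I : Set ι, α - ∑ i, e i • v i ∈ Submodule.span ℝ (v '' I) →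
      α ∈ Submodule.span ℝ (v '' I) := by
  refine Filter.eventually_all.2 fun I => ?_
  have := FiniteDimensional.span_of_finite ℝ (I.toFinite.image v)
  have hclosed := (Submodule.span ℝ (v '' I)).closed_of_finiteDimensional
  by_cases hα : α ∈ Submodule.span ℝ (v '' I)
  · exact .of_forall fun _ _ => hα
  · have hcont : Continuous fun e : ι → ℝ => α - ∑ i, e i • v i := by fun_prop
    have hα' : α - ∑ i, (0 : ι → ℝ) i • v i ∉ Submodule.span ℝ (v '' I) := by simpa using hα
    exact (hcont.continuousAt.eventually (hclosed.isOpen_compl.mem_nhds hα')).mono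
      fun e he h => absurd h he

theorem exists_pos_forall_mem_span (v : ι → E) (α : E) :
    ∃ ε > 0, ∀ d : ι → ℝ, ∑ i, d i • v i = α → α ∈ Submodule.span ℝ (v '' {i | ε < |d i|}) := by
  classical
  obtain ⟨r, hr, hball⟩ :=
    Metric.eventually_nhds_iff.1 (eventually_forall_sub_sum_smul_mem_span v α)
  refine ⟨r / 2, half_pos hr, fun d hd => ?_⟩
  set I : Set ι := {i | r / 2 < |d i|}
  have he : dist (Iᶜ.indicator d) 0 < r := by
    refine lt_of_le_of_lt ((dist_pi_le_iff (half_pos hr).le).2 fun i => ?_) (half_lt_self hr)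
    by_cases hi : i ∈ I
    · simpa [hi] using (half_pos hr).le
    · simpa [hi] using not_lt.1 hi
  refine hball he I ?_
  rw [← hd, ← Finset.sum_sub_distrib]
  refine Submodule.sum_mem _ fun i _ => ?_
  by_cases hi : i ∈ I
  · simpa [hi] using Submodule.smul_mem _ (d i) (Submodule.subset_span (Set.mem_image_of_mem v hi))
  · simp [hi]

theorem exists_sum_smul_eq_of_mem_span_image {v : ι → E} {I : Set ι} {α : E}
    (h : α ∈ Submodule.span ℝ (v '' I)) :
    ∃ d : ι → ℝ, (∀ i, d i ≠ 0 → i ∈ I) ∧ ∑ i, d i • v i = α := by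
  obtain ⟨d, hd, rfl⟩ := (Finsupp.mem_span_image_iff_linearCombination ℝ).1 h
  refine ⟨d, fun i hi => hd (Finsupp.mem_support_iff.2 hi), ?_⟩
  rw [Finsupp.linearCombination_apply, Finsupp.sum_fintype _ _ fun i => zero_smul ℝ (v i)]

end SmallCoefficients

section DualFrame

variable {ι V : Type*} [NormedAddCommGroup V] [NormedSpace ℝ V]

/-- The linear forms `ℓ i`, `i ∈ I`, separate the points of `V`; equivalently, when `V` is
finite-dimensional, they span its dual. -/
def Separates (ℓ : ι → V →L[ℝ] ℝ) (I : Set ι) : Prop :=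
  ∀ x, (∀ i ∈ I, ℓ i x = 0) → x = 0

theorem Separates.mono {ℓ : ι → V →L[ℝ] ℝ} {I J : Set ι} (h : Separates ℓ I) (hIJ : I ⊆ J) :
    Separates ℓ J :=
  fun x hx => h x fun i hi => hx i (hIJ hi)

variable [Fintype ι]

theorem exists_pos_forall_separates {ℓ : ι → V →L[ℝ] ℝ} {α : V →L[ℝ] ℝ}
    (h : ∀ d : ι → ℝ, ∑ i, d i • ℓ i = α → Separates ℓ {i | d i ≠ 0}) :
    ∃ ε > 0, ∀ d : ι → ℝ, ∑ i, d i • ℓ i = α → Separates ℓ {i | ε < |d i|} := by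
  obtain ⟨ε, hε, hspan⟩ := exists_pos_forall_mem_span ℓ α
  refine ⟨ε, hε, fun d hd => ?_⟩
  obtain ⟨c, hcsupp, hc⟩ := exists_sum_smul_eq_of_mem_span_image (hspan d hd)
  exact (h c hc).mono hcsupp

/-- The Gram form `∑ aᵢ ℓᵢ ⊗ ℓᵢ` of the forms `ℓᵢ` with weights `aᵢ`, as a map `V → V^*`. -/
noncomputable def weightedGram (ℓ : ι → V →L[ℝ] ℝ) (a : ι → ℝ) : V →L[ℝ] V →L[ℝ] ℝ :=
  ∑ i, (ℓ i).smulRight (a i • ℓ i)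

theorem weightedGram_apply (ℓ : ι → V →L[ℝ] ℝ) (a : ι → ℝ) (x : V) :
    weightedGram ℓ a x = ∑ i, ℓ i x • a i • ℓ i := by
  simp [weightedGram, sum_apply]

theorem contDiff_weightedGram (ℓ : ι → V →L[ℝ] ℝ) : ContDiff ℝ ∞ (weightedGram ℓ) :=
  ContDiff.sum fun i _ => contDiff_const.smulRight ((contDiff_apply ℝ ℝ i).smul contDiff_const)

theorem injective_weightedGram {ℓ : ι → V →L[ℝ] ℝ} {a : ι → ℝ} (ha : ∀ i, 0 ≤ a i)
    (hsep : Separates ℓ {i | a i ≠ 0}) : Function.Injective (weightedGram ℓ a) := by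
  refine (injective_iff_map_eq_zero _).2 fun x hx => hsep x fun i hi => ?_
  have hsum : ∑ i, a i * ℓ i x ^ 2 = 0 := by
    simpa [weightedGram_apply, sum_apply, sq, mul_left_comm] using DFunLike.congr_fun hx x
  have hterm := (Finset.sum_eq_zero_iff_of_nonneg
    fun i _ => mul_nonneg (ha i) (sq_nonneg (ℓ i x))).1 hsum i (Finset.mem_univ i)
  exact pow_eq_zero_iff two_ne_zero |>.1 ((mul_eq_zero.1 hterm).resolve_left hi)

/-- The canonical dual frame of the forms `ℓᵢ` with weights `aᵢ`: the vectors `aᵢ G⁻¹ ℓᵢ`, where `G`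
is the weighted Gram form. They are only meaningful where `G` is invertible. -/
noncomputable def dualFrame (ℓ : ι → V →L[ℝ] ℝ) (a : ι → ℝ) (i : ι) : V :=
  a i • (weightedGram ℓ a).inverse (ℓ i)

theorem dualFrame_eq_zero (ℓ : ι → V →L[ℝ] ℝ) {a : ι → ℝ} {i : ι} (h : a i = 0) :
    dualFrame ℓ a i = 0 := by
  rw [dualFrame, h, zero_smul]

variable [FiniteDimensional ℝ V]

theorem isInvertible_weightedGram {ℓ : ι → V →L[ℝ] ℝ} {a : ι → ℝ} (ha : ∀ i, 0 ≤ a i)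
    (hsep : Separates ℓ {i | a i ≠ 0}) : (weightedGram ℓ a).IsInvertible := by
  have hdim : Module.finrank ℝ V = Module.finrank ℝ (V →L[ℝ] ℝ) := by
    rw [← (LinearMap.toContinuousLinearMap (𝕜 := ℝ) (E := V) (F' := ℝ)).finrank_eq]
    exact (Subspace.dual_finrank_eq (K := ℝ) (V := V)).symm
  exact ⟨(LinearEquiv.ofInjectiveOfFinrankEq (weightedGram ℓ a).toLinearMap
    (injective_weightedGram ha hsep) hdim).toContinuousLinearEquiv, rfl⟩

theorem sum_smul_dualFrame {ℓ : ι → V →L[ℝ] ℝ} {a : ι → ℝ} (ha : ∀ i, 0 ≤ a i)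
    (hsep : Separates ℓ {i | a i ≠ 0}) (x : V) : ∑ i, ℓ i x • dualFrame ℓ a i = x := by
  calc ∑ i, ℓ i x • dualFrame ℓ a i = (weightedGram ℓ a).inverse (weightedGram ℓ a x) := by
        simp only [weightedGram_apply, map_sum, map_smul, dualFrame]
    _ = x := (isInvertible_weightedGram ha hsep).inverse_apply_eq.2 rfl

theorem contDiffAt_dualFrame (ℓ : ι → V →L[ℝ] ℝ) {a : ι → ℝ} (ha : ∀ i, 0 ≤ a i)
    (hsep : Separates ℓ {i | a i ≠ 0}) (i : ι) :
    ContDiffAt ℝ ∞ (fun b => dualFrame ℓ b i) a := by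
  have : CompleteSpace V := FiniteDimensional.complete ℝ V
  have hinv := (isInvertible_weightedGram ha hsep).contDiffAt_map_inverse (n := ∞)
  exact (contDiff_apply ℝ ℝ i).contDiffAt.smul
    ((hinv.comp a (contDiff_weightedGram ℓ).contDiffAt).clm_apply contDiffAt_const)

end DualFrame

section QuaternionicLine

/-- The real moment map `(z, w) ↦ |z|² - |w|²` of the circle action on the quaternionic line. -/
noncomputable def normSqSub (q : ℂ × ℂ) : ℝ := ‖q.1‖ ^ 2 - ‖q.2‖ ^ 2

theorem normSqSub_swap (q : ℂ × ℂ) : normSqSub q.swap = -normSqSub q := by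
  simp [normSqSub]

theorem contDiff_normSqSub : ContDiff ℝ ∞ normSqSub :=
  (contDiff_fst.norm_sq ℝ).sub (contDiff_snd.norm_sq ℝ)

theorem fst_ne_zero_of_normSqSub_pos {q : ℂ × ℂ} (hq : 0 < normSqSub q) : q.1 ≠ 0 := by
  intro h
  rw [normSqSub, h, norm_zero] at hq
  linarith [sq_nonneg ‖q.2‖]

/-- The value of `|z|` determined by `|z|² - |w|² = d` and `z w = c`. -/
noncomputable def levelRadius (d : ℝ) (c : ℂ) : ℝ := √((d + √(d ^ 2 + 4 * ‖c‖ ^ 2)) / 2)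

theorem levelRadius_normSqSub_mul (q : ℂ × ℂ) : levelRadius (normSqSub q) (q.1 * q.2) = ‖q.1‖ := by
  have hdisc : normSqSub q ^ 2 + 4 * ‖q.1 * q.2‖ ^ 2 = (‖q.1‖ ^ 2 + ‖q.2‖ ^ 2) ^ 2 := by
    rw [normSqSub, norm_mul]; ring
  have hroot : (normSqSub q + (‖q.1‖ ^ 2 + ‖q.2‖ ^ 2)) / 2 = ‖q.1‖ ^ 2 := by
    rw [normSqSub]; ring
  rw [levelRadius, hdisc, Real.sqrt_sq (by positivity), hroot, Real.sqrt_sq (norm_nonneg _)]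

theorem levelRadius_pos {d : ℝ} (hd : 0 < d) (c : ℂ) : 0 < levelRadius d c :=
  Real.sqrt_pos.2 (by positivity)

theorem levelRadius_sq_sub {d : ℝ} (hd : 0 < d) (c : ℂ) :
    levelRadius d c ^ 2 - (‖c‖ / levelRadius d c) ^ 2 = d := by
  have hr := levelRadius_pos hd c
  have hdisc : √(d ^ 2 + 4 * ‖c‖ ^ 2) ^ 2 = d ^ 2 + 4 * ‖c‖ ^ 2 := Real.sq_sqrt (by positivity)
  have hrsq : levelRadius d c ^ 2 = (d + √(d ^ 2 + 4 * ‖c‖ ^ 2)) / 2 :=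
    Real.sq_sqrt (by positivity)
  have hquad : levelRadius d c ^ 2 * levelRadius d c ^ 2 - ‖c‖ ^ 2 = d * levelRadius d c ^ 2 := by
    rw [hrsq]; linarith
  field_simp
  linarith

theorem contDiffAt_levelRadius {d : ℝ} (hd : 0 < d) (c : ℂ) :
    ContDiffAt ℝ ∞ (fun u : ℝ × ℂ => levelRadius u.1 u.2) (d, c) := by
  have hdisc : ContDiff ℝ ∞ fun u : ℝ × ℂ => u.1 ^ 2 + 4 * ‖u.2‖ ^ 2 :=
    (contDiff_fst.pow 2).add (contDiff_const.mul (contDiff_snd.norm_sq ℝ))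
  have hsqrt := hdisc.contDiffAt.sqrt (x := (d, c)) (by positivity)
  exact ((contDiffAt_fst.add hsqrt).div_const 2).sqrt (by positivity)

/-- For `|z|² > |w|²`, the point `(z', w')` with `z' w' = c` and `|z'|² - |w'|² = |z|² - |w|²` for
which `z'` is a positive multiple of `z`. -/
noncomputable def moveProdOfPos (q : ℂ × ℂ) (c : ℂ) : ℂ × ℂ :=
  let z := (levelRadius (normSqSub q) c / ‖q.1‖) • q.1
  (z, c / z)

theorem norm_moveProdOfPos_fst {q : ℂ × ℂ} (hq : 0 < normSqSub q) (c : ℂ) :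
    ‖(moveProdOfPos q c).1‖ = levelRadius (normSqSub q) c := by
  have hz := fst_ne_zero_of_normSqSub_pos hq
  rw [moveProdOfPos, norm_smul, Real.norm_of_nonneg (by unfold levelRadius; positivity),
    div_mul_cancel₀ _ (norm_ne_zero_iff.2 hz)]

theorem moveProdOfPos_fst_mul_snd {q : ℂ × ℂ} (hq : 0 < normSqSub q) (c : ℂ) :
    (moveProdOfPos q c).1 * (moveProdOfPos q c).2 = c := by
  refine mul_div_cancel₀ c (norm_ne_zero_iff.1 ?_)
  exact (norm_moveProdOfPos_fst hq c).trans_ne (levelRadius_pos hq c).ne'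

theorem normSqSub_moveProdOfPos {q : ℂ × ℂ} (hq : 0 < normSqSub q) (c : ℂ) :
    normSqSub (moveProdOfPos q c) = normSqSub q := by
  have hsnd : ‖(moveProdOfPos q c).2‖ = ‖c‖ / levelRadius (normSqSub q) c := by
    rw [← norm_moveProdOfPos_fst hq c]
    exact norm_div _ _
  rw [normSqSub, norm_moveProdOfPos_fst hq, hsnd, levelRadius_sq_sub hq]

theorem moveProdOfPos_moveProdOfPos {q : ℂ × ℂ} (hq : 0 < normSqSub q) (c c' : ℂ) :
    moveProdOfPos (moveProdOfPos q c) c' = moveProdOfPos q c' := by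
  have hr := (levelRadius_pos hq c).ne'
  have hfst : (moveProdOfPos (moveProdOfPos q c) c').1 = (moveProdOfPos q c').1 := by
    change (levelRadius (normSqSub (moveProdOfPos q c)) c' / ‖(moveProdOfPos q c).1‖) •
      (levelRadius (normSqSub q) c / ‖q.1‖) • q.1 = (levelRadius (normSqSub q) c' / ‖q.1‖) • q.1
    rw [normSqSub_moveProdOfPos hq, norm_moveProdOfPos_fst hq, smul_smul, div_mul_div_cancel₀ hr]
  exact Prod.ext hfst (congrArg (c' / ·) hfst)

theorem moveProdOfPos_self {q : ℂ × ℂ} (hq : 0 < normSqSub q) :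
    moveProdOfPos q (q.1 * q.2) = q := by
  have hz := fst_ne_zero_of_normSqSub_pos hq
  rw [moveProdOfPos, levelRadius_normSqSub_mul, div_self (norm_ne_zero_iff.2 hz), one_smul,
    mul_div_cancel_left₀ _ hz]

theorem contDiffAt_moveProdOfPos {q : ℂ × ℂ} (hq : 0 < normSqSub q) (c : ℂ) :
    ContDiffAt ℝ ∞ (fun u : (ℂ × ℂ) × ℂ => moveProdOfPos u.1 u.2) (q, c) := by
  have hz := fst_ne_zero_of_normSqSub_pos hq
  have hradius : ContDiffAt ℝ ∞ (fun u : (ℂ × ℂ) × ℂ => levelRadius (normSqSub u.1) u.2) (q, c) :=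
    (contDiffAt_levelRadius hq c).comp (f := fun u : (ℂ × ℂ) × ℂ => (normSqSub u.1, u.2)) (q, c)
      ((contDiff_normSqSub.comp contDiff_fst).prodMk contDiff_snd).contDiffAt
  have hfst : ContDiffAt ℝ ∞ (fun u : (ℂ × ℂ) × ℂ => u.1.1) (q, c) :=
    contDiff_fst.fst.contDiffAt
  have hz' : ContDiffAt ℝ ∞ (fun u : (ℂ × ℂ) × ℂ => (moveProdOfPos u.1 u.2).1) (q, c) :=
    (hradius.div (hfst.norm ℝ hz) (norm_ne_zero_iff.2 hz)).smul hfst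
  have hne : (moveProdOfPos q c).1 ≠ 0 :=
    norm_ne_zero_iff.1 ((norm_moveProdOfPos_fst hq c).trans_ne (levelRadius_pos hq c).ne')
  exact hz'.prodMk (contDiffAt_snd.mul (hz'.inv hne))

/-- Changes the product of the coordinates of `q` to `c`, keeping the value `d` of `normSqSub` and
the phase of the larger coordinate. This cannot be done continuously at `d = 0`, where `q` is left
alone. -/
noncomputable def moveProd (q : ℂ × ℂ) (c : ℂ) : ℂ × ℂ :=
  if 0 < normSqSub q then moveProdOfPos q c
  else if normSqSub q < 0 then (moveProdOfPos q.swap c).swap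
  else q

theorem moveProd_of_pos {q : ℂ × ℂ} (hq : 0 < normSqSub q) (c : ℂ) :
    moveProd q c = moveProdOfPos q c :=
  if_pos hq

theorem moveProd_swap (q : ℂ × ℂ) (c : ℂ) : moveProd q.swap c = (moveProd q c).swap := by
  rcases lt_trichotomy (normSqSub q) 0 with h | h | h
  · simp [moveProd, normSqSub_swap, h, h.not_gt]
  · simp [moveProd, normSqSub_swap, h]
  · simp [moveProd, normSqSub_swap, h, h.not_gt]

theorem moveProd_of_eq_zero {q : ℂ × ℂ} (hq : normSqSub q = 0) (c : ℂ) : moveProd q c = q := by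
  simp [moveProd, hq]

theorem normSqSub_swap_pos {q : ℂ × ℂ} (hq : normSqSub q < 0) : 0 < normSqSub q.swap := by
  rwa [normSqSub_swap, neg_pos]

/-- Since `moveProd` commutes with the exchange of coordinates, its properties need only be checked
for `normSqSub q ≥ 0`. -/
theorem quaternionic_cases {P : ℂ × ℂ → Prop} (zero : ∀ q, normSqSub q = 0 → P q)
    (pos : ∀ q, 0 < normSqSub q → P q) (swap : ∀ q, P q.swap → P q) (q : ℂ × ℂ) : P q := by
  rcases lt_trichotomy (normSqSub q) 0 with h | h | h
  · exact swap q (pos _ (normSqSub_swap_pos h))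
  · exact zero q h
  · exact pos q h

theorem normSqSub_moveProd (q : ℂ × ℂ) (c : ℂ) : normSqSub (moveProd q c) = normSqSub q := by
  induction q using quaternionic_cases with
  | zero q h => rw [moveProd_of_eq_zero h]
  | pos q h => rw [moveProd_of_pos h, normSqSub_moveProdOfPos h]
  | swap q h => rwa [moveProd_swap, normSqSub_swap, normSqSub_swap, neg_inj] at h

theorem moveProd_fst_mul_snd {q : ℂ × ℂ} (hq : normSqSub q ≠ 0) (c : ℂ) :
    (moveProd q c).1 * (moveProd q c).2 = c := by
  induction q using quaternionic_cases with
  | zero q h => exact absurd h hq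
  | pos q h => rw [moveProd_of_pos h, moveProdOfPos_fst_mul_snd h]
  | swap q h =>
    rw [normSqSub_swap, neg_ne_zero, moveProd_swap] at h
    rw [mul_comm]
    exact h hq

theorem moveProd_moveProd (q : ℂ × ℂ) (c c' : ℂ) :
    moveProd (moveProd q c) c' = moveProd q c' := by
  induction q using quaternionic_cases with
  | zero q h => rw [moveProd_of_eq_zero h]
  | pos q h =>
    rw [moveProd_of_pos (q := moveProd q c) (by rwa [normSqSub_moveProd]), moveProd_of_pos h,
      moveProd_of_pos h, moveProdOfPos_moveProdOfPos h]
  | swap q h => simpa only [moveProd_swap, Prod.swap_inj] using h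

theorem moveProd_self (q : ℂ × ℂ) : moveProd q (q.1 * q.2) = q := by
  induction q using quaternionic_cases with
  | zero q h => exact moveProd_of_eq_zero h _
  | pos q h => rw [moveProd_of_pos h, moveProdOfPos_self h]
  | swap q h => rwa [moveProd_swap, Prod.swap_inj, Prod.fst_swap, Prod.snd_swap, mul_comm] at h

/-- The hyperkähler action of the circle on the quaternionic line. -/
noncomputable def rotate (ζ : Circle) (q : ℂ × ℂ) : ℂ × ℂ := (ζ * q.1, (ζ⁻¹ : Circle) * q.2)

theorem rotate_swap (ζ : Circle) (q : ℂ × ℂ) : rotate ζ q.swap = (rotate ζ⁻¹ q).swap := by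
  simp [rotate]

theorem normSqSub_rotate (ζ : Circle) (q : ℂ × ℂ) : normSqSub (rotate ζ q) = normSqSub q := by
  simp only [normSqSub, rotate, norm_mul, Circle.norm_coe, one_mul]

theorem moveProdOfPos_rotate (ζ : Circle) (q : ℂ × ℂ) (c : ℂ) :
    moveProdOfPos (rotate ζ q) c = rotate ζ (moveProdOfPos q c) := by
  have hfst : (moveProdOfPos (rotate ζ q) c).1 = ζ * (moveProdOfPos q c).1 := by
    simp only [moveProdOfPos, normSqSub_rotate]
    simp only [rotate, norm_mul, Circle.norm_coe, one_mul, mul_smul_comm]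
  refine Prod.ext hfst ?_
  change c / (moveProdOfPos (rotate ζ q) c).1 = (ζ⁻¹ : Circle) * (c / (moveProdOfPos q c).1)
  rw [hfst, Circle.coe_inv, div_mul_eq_div_div_swap, div_eq_inv_mul]

theorem moveProd_rotate (ζ : Circle) (q : ℂ × ℂ) (c : ℂ) :
    moveProd (rotate ζ q) c = rotate ζ (moveProd q c) := by
  induction q using quaternionic_cases generalizing ζ with
  | zero q h => rw [moveProd_of_eq_zero h, moveProd_of_eq_zero (by rwa [normSqSub_rotate])]
  | pos q h =>
    rw [moveProd_of_pos h, moveProd_of_pos (by rwa [normSqSub_rotate]), moveProdOfPos_rotate]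
  | swap q h => simpa only [rotate_swap, moveProd_swap, inv_inv, Prod.swap_inj] using h ζ⁻¹

theorem contDiffAt_moveProd {q : ℂ × ℂ} (hq : normSqSub q ≠ 0) (c : ℂ) :
    ContDiffAt ℝ ∞ (fun u : (ℂ × ℂ) × ℂ => moveProd u.1 u.2) (q, c) := by
  induction q using quaternionic_cases with
  | zero q h => exact absurd h hq
  | pos q h =>
    refine (contDiffAt_moveProdOfPos h c).congr_of_eventuallyEq ?_
    have hpos : ∀ᶠ u : (ℂ × ℂ) × ℂ in 𝓝 (q, c), 0 < normSqSub u.1 :=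
      (contDiff_normSqSub.continuous.comp continuous_fst).continuousAt.eventually_const_lt h
    exact hpos.mono fun u hu => moveProd_of_pos hu u.2
  | swap q h =>
    have hswap : ContDiff ℝ ∞ (Prod.swap : ℂ × ℂ → ℂ × ℂ) := contDiff_snd.prodMk contDiff_fst
    have h' := h (by rwa [normSqSub_swap, neg_ne_zero])
    have hcomp := hswap.contDiffAt.comp (q, c)
      (h'.comp (q, c) ((hswap.comp contDiff_fst).prodMk contDiff_snd).contDiffAt)
    simpa [Function.comp_def, moveProd_swap] using hcomp

end QuaternionicLine

section Relocation

variable {N : ℕ}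

/-- The `i`-th quaternionic coordinate. -/
def coord (p : HN N) (i : Fin N) : ℂ × ℂ := (p.1 i, p.2 i)

theorem act_fst_mul_snd (ζ : Torus N) (p : HN N) (i : Fin N) :
    (act ζ p).1 i * (act ζ p).2 i = p.1 i * p.2 i := by
  rw [act, mul_mul_mul_comm, ← Circle.coe_mul, mul_inv_cancel, Circle.coe_one, one_mul]

theorem coord_act (ζ : Torus N) (p : HN N) (i : Fin N) :
    coord (act ζ p) i = rotate (ζ i) (coord p i) :=
  rfl

theorem eq_of_coord_eq {p q : HN N} (h : ∀ i, coord p i = coord q i) : p = q :=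
  Prod.ext (funext fun i => congrArg Prod.fst (h i)) (funext fun i => congrArg Prod.snd (h i))

theorem contDiff_coord (i : Fin N) : ContDiff ℝ ∞ fun p : HN N => coord p i :=
  ((contDiff_apply ℝ ℂ i).comp contDiff_fst).prodMk ((contDiff_apply ℝ ℂ i).comp contDiff_snd)

/-- The moment map `(|z_i|² - |w_i|²)_i` of the full torus. -/
noncomputable def torusMoment (p : HN N) : Fin N → ℝ := fun i => normSqSub (coord p i)

theorem contDiff_torusMoment : ContDiff ℝ ∞ (torusMoment (N := N)) :=
  contDiff_pi.2 fun i => contDiff_normSqSub.comp (contDiff_coord i)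

/-- A smooth function of `t` which vanishes for `|t| ≤ ε` and is positive otherwise. -/
noncomputable def cutoff (ε t : ℝ) : ℝ := Real.smoothTransition (t ^ 2 - ε ^ 2)

theorem cutoff_nonneg (ε t : ℝ) : 0 ≤ cutoff ε t := Real.smoothTransition.nonneg _

theorem cutoff_eq_zero_iff {ε : ℝ} (hε : 0 ≤ ε) (t : ℝ) : cutoff ε t = 0 ↔ |t| ≤ ε := by
  rw [cutoff, Real.smoothTransition.zero_iff_nonpos, sub_nonpos, sq_le_sq, abs_of_nonneg hε]

theorem contDiff_cutoff (ε : ℝ) : ContDiff ℝ ∞ (cutoff ε) :=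
  Real.smoothTransition.contDiff.comp ((contDiff_id.pow 2).sub contDiff_const)

variable (K : Subgroup (Torus N)) (ε : ℝ)

theorem mu1_eq (p : HN N) : mu1 K p = Real.pi • ∑ i, torusMoment p i • iotaU K i := rfl

theorem muC_act (ζ : Torus N) (p : HN N) : muC K (act ζ p) = muC K p := by
  simp only [muC, act_fst_mul_snd]

theorem contDiff_muC : ContDiff ℝ ∞ (muC K) := by
  refine ContDiff.sum fun i _ => contDiff_const.smulRight ?_
  fun_prop

theorem contDiff_mu : ContDiff ℝ ∞ (mu K) := by
  have hterm (i : Fin N) : ContDiff ℝ ∞ fun p : HN N => torusMoment p i • iotaU K i :=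
    ((contDiff_apply ℝ ℝ i).comp contDiff_torusMoment).smul contDiff_const
  exact ((ContDiff.sum fun i _ => hterm i).const_smul Real.pi).prodMk (contDiff_muC K)

/-- The dual frame of the forms `ι^* u_i`, weighted so that only the indices `i` with
`||z_i|² - |w_i|²| > ε` contribute. -/
noncomputable def momentFrame (p : HN N) (i : Fin N) : Lie K :=
  dualFrame (iotaU K) (fun j => cutoff ε (torusMoment p j)) i

/-- The values of the products `z_i w_i` to which the ones of `p` are changed in order to change
`μ_ℂ(p)` to `β`. -/
noncomputable def prodTarget (p : HN N) (β : kDualC K) (i : Fin N) : ℂ :=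
  p.1 i * p.2 i + (-2 * (Real.pi : ℂ) * Complex.I)⁻¹ * (β - muC K p) (momentFrame K ε p i)

/-- Moves `p` to a point of `μ_ℂ⁻¹(β)` by changing the products `z_i w_i` only. -/
noncomputable def relocate (p : HN N) (β : kDualC K) : HN N :=
  (fun i => (moveProd (coord p i) (prodTarget K ε p β i)).1,
    fun i => (moveProd (coord p i) (prodTarget K ε p β i)).2)

/-- The set on which `relocate` is well behaved: there the indices `i` with
`||z_i|² - |w_i|²| > ε` suffice to separate the points of `k`. -/
def separatingLocus : Set (HN N) :=
  {p | Separates (iotaU K) {i | ε < |torusMoment p i|}}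

theorem isOpen_separatingLocus : IsOpen (separatingLocus K ε) := by
  refine isOpen_iff_mem_nhds.2 fun p hp => ?_
  have hnear : ∀ᶠ q in 𝓝 p, ∀ i, ε < |torusMoment p i| → ε < |torusMoment q i| := by
    refine Filter.eventually_all.2 fun i => ?_
    have hcont : Continuous fun q : HN N => |torusMoment q i| :=
      ((continuous_apply i).comp contDiff_torusMoment.continuous).abs
    by_cases hi : ε < |torusMoment p i|
    · exact (hcont.continuousAt.eventually_const_lt hi).mono fun _ h _ => h
    · exact .of_forall fun _ h => absurd h hi
  exact hnear.mono fun q hq => hp.mono hq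

variable {K ε}

theorem coord_relocate (p : HN N) (β : kDualC K) (i : Fin N) :
    coord (relocate K ε p β) i = moveProd (coord p i) (prodTarget K ε p β i) :=
  rfl

theorem torusMoment_relocate (p : HN N) (β : kDualC K) :
    torusMoment (relocate K ε p β) = torusMoment p :=
  funext fun i => normSqSub_moveProd (coord p i) _

theorem torusMoment_act (ζ : Torus N) (p : HN N) : torusMoment (act ζ p) = torusMoment p :=
  funext fun i => normSqSub_rotate (ζ i) (coord p i)

theorem mu1_relocate (p : HN N) (β : kDualC K) : mu1 K (relocate K ε p β) = mu1 K p := by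
  rw [mu1_eq, mu1_eq, torusMoment_relocate]

theorem momentFrame_congr {p q : HN N} (h : torusMoment p = torusMoment q) :
    momentFrame K ε p = momentFrame K ε q := by
  unfold momentFrame
  rw [h]

theorem prodTarget_of_abs_le (hε : 0 ≤ ε) {p : HN N} {i : Fin N} (h : |torusMoment p i| ≤ ε)
    (β : kDualC K) : prodTarget K ε p β i = p.1 i * p.2 i := by
  have hframe : momentFrame K ε p i = 0 := dualFrame_eq_zero _ ((cutoff_eq_zero_iff hε _).2 h)
  rw [prodTarget, hframe, map_zero, mul_zero, add_zero]

theorem moveProd_prodTarget_of_abs_le (hε : 0 ≤ ε) {p : HN N} {i : Fin N}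
    (h : |torusMoment p i| ≤ ε) (β : kDualC K) :
    moveProd (coord p i) (prodTarget K ε p β i) = coord p i := by
  rw [prodTarget_of_abs_le hε h]
  exact moveProd_self (coord p i)

theorem relocate_fst_mul_snd (hε : 0 ≤ ε) (p : HN N) (β : kDualC K) (i : Fin N) :
    (relocate K ε p β).1 i * (relocate K ε p β).2 i = prodTarget K ε p β i := by
  by_cases h : torusMoment p i = 0
  · have hle : |torusMoment p i| ≤ ε := by rwa [h, abs_zero]
    change (moveProd _ _).1 * (moveProd _ _).2 = _
    rw [moveProd_prodTarget_of_abs_le hε hle, prodTarget_of_abs_le hε hle]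
    rfl
  · exact moveProd_fst_mul_snd h _

theorem relocate_act (ζ : Torus N) (p : HN N) (β : kDualC K) :
    relocate K ε (act ζ p) β = act ζ (relocate K ε p β) := by
  refine eq_of_coord_eq fun i => ?_
  have htarget : prodTarget K ε (act ζ p) β i = prodTarget K ε p β i := by
    rw [prodTarget, muC_act, momentFrame_congr (torusMoment_act ζ p), act_fst_mul_snd, prodTarget]
  rw [coord_relocate, htarget, coord_act, moveProd_rotate, coord_act, coord_relocate]

theorem relocate_muC_self (p : HN N) : relocate K ε p (muC K p) = p := by
  refine eq_of_coord_eq fun i => ?_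
  rw [coord_relocate, prodTarget, sub_self, zero_apply, mul_zero, add_zero]
  exact moveProd_self (coord p i)

theorem separates_cutoff (hε : 0 ≤ ε) {p : HN N} (hp : p ∈ separatingLocus K ε) :
    Separates (iotaU K) {i | cutoff ε (torusMoment p i) ≠ 0} :=
  hp.mono fun _ hi => (cutoff_eq_zero_iff hε _).not.2 hi.not_ge

theorem sum_iotaU_smul_momentFrame (hε : 0 ≤ ε) {p : HN N} (hp : p ∈ separatingLocus K ε)
    (x : Lie K) : ∑ i, iotaU K i x • momentFrame K ε p i = x :=
  sum_smul_dualFrame (fun _ => cutoff_nonneg ε _) (separates_cutoff hε hp) x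

theorem muC_apply (p : HN N) (x : Lie K) :
    muC K p x = ∑ i, iotaU K i x • (-2 * (Real.pi : ℂ) * Complex.I * (p.1 i * p.2 i)) := by
  simp only [muC, sum_apply, ContinuousLinearMap.smulRight_apply]

theorem muC_relocate (hε : 0 ≤ ε) {p : HN N} (hp : p ∈ separatingLocus K ε) (β : kDualC K) :
    muC K (relocate K ε p β) = β := by
  ext x
  have hπ : -2 * (Real.pi : ℂ) * Complex.I ≠ 0 := by simp [Real.pi_ne_zero]
  calc muC K (relocate K ε p β) x
      = ∑ i, iotaU K i x • (-2 * (Real.pi : ℂ) * Complex.I * prodTarget K ε p β i) := by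
        simp only [muC_apply, relocate_fst_mul_snd hε]
    _ = muC K p x + (β - muC K p) (∑ i, iotaU K i x • momentFrame K ε p i) := by
        simp only [prodTarget, mul_add, mul_inv_cancel_left₀ hπ, smul_add, Finset.sum_add_distrib,
          muC_apply, map_sum, map_smul]
    _ = β x := by
        rw [sum_iotaU_smul_momentFrame hε hp, sub_apply, add_sub_cancel]

theorem relocate_relocate (hε : 0 ≤ ε) {p : HN N} (hp : p ∈ separatingLocus K ε)
    (β γ : kDualC K) : relocate K ε (relocate K ε p β) γ = relocate K ε p γ := by
  refine eq_of_coord_eq fun i => ?_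
  have htarget : prodTarget K ε (relocate K ε p β) γ i = prodTarget K ε p γ i := by
    rw [prodTarget, relocate_fst_mul_snd hε, momentFrame_congr (torusMoment_relocate p β),
      muC_relocate hε hp, prodTarget, prodTarget, add_assoc, ← mul_add, ← add_apply,
      sub_add_sub_cancel']
  rw [coord_relocate, coord_relocate, htarget, moveProd_moveProd, coord_relocate]

theorem contDiffAt_momentFrame (hε : 0 ≤ ε) {p : HN N} (hp : p ∈ separatingLocus K ε)
    (i : Fin N) : ContDiffAt ℝ ∞ (fun q => momentFrame K ε q i) p := by
  have hweights : ContDiff ℝ ∞ fun (q : HN N) (j : Fin N) => cutoff ε (torusMoment q j) :=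
    contDiff_pi.2 fun j =>
      (contDiff_cutoff ε).comp ((contDiff_apply ℝ ℝ j).comp contDiff_torusMoment)
  exact (contDiffAt_dualFrame (iotaU K) (fun _ => cutoff_nonneg ε _) (separates_cutoff hε hp)
    i).comp p hweights.contDiffAt

theorem contDiffAt_prodTarget (hε : 0 ≤ ε) {p : HN N} (hp : p ∈ separatingLocus K ε)
    (β : kDualC K) (i : Fin N) :
    ContDiffAt ℝ ∞ (fun u : HN N × kDualC K => prodTarget K ε u.1 u.2 i) (p, β) := by
  have hprod : ContDiff ℝ ∞ fun u : HN N × kDualC K => u.1.1 i * u.1.2 i := by fun_prop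
  have hdiff : ContDiff ℝ ∞ fun u : HN N × kDualC K => u.2 - muC K u.1 :=
    contDiff_snd.sub ((contDiff_muC K).comp contDiff_fst)
  have hframe := (contDiffAt_momentFrame hε hp i).comp (p, β) contDiffAt_fst
  exact hprod.contDiffAt.add (contDiffAt_const.mul (hdiff.contDiffAt.clm_apply hframe))

/-- Where `|z_i|² = |w_i|²`, the map `moveProd` is not smooth, but there the cutoff keeps the `i`-th
coordinate fixed. -/
theorem contDiffAt_coord_relocate (hε : 0 < ε) {p : HN N} (hp : p ∈ separatingLocus K ε)
    (β : kDualC K) (i : Fin N) :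
    ContDiffAt ℝ ∞ (fun u : HN N × kDualC K => coord (relocate K ε u.1 u.2) i) (p, β) := by
  have hcoord : ContDiff ℝ ∞ fun u : HN N × kDualC K => coord u.1 i :=
    (contDiff_coord i).comp contDiff_fst
  by_cases hi : torusMoment p i = 0
  · have hcont : Continuous fun u : HN N × kDualC K => |torusMoment u.1 i| :=
      (contDiff_normSqSub.comp hcoord).continuous.abs
    have hsmall : ∀ᶠ u : HN N × kDualC K in 𝓝 (p, β), |torusMoment u.1 i| < ε :=
      hcont.continuousAt.eventually_lt_const ((abs_eq_zero.2 hi).trans_lt hε)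
    exact hcoord.contDiffAt.congr_of_eventuallyEq
      (hsmall.mono fun u hu => moveProd_prodTarget_of_abs_le hε.le hu.le u.2)
  · exact (contDiffAt_moveProd hi _).comp (f := fun u : HN N × kDualC K =>
      (coord u.1 i, prodTarget K ε u.1 u.2 i)) (p, β)
      (hcoord.contDiffAt.prodMk (contDiffAt_prodTarget hε.le hp β i))

theorem contDiffOn_relocate (hε : 0 < ε) :
    ContDiffOn ℝ ∞ (fun u : HN N × kDualC K => relocate K ε u.1 u.2)
      (separatingLocus K ε ×ˢ Set.univ) := fun u hu =>
  have hcoord i := contDiffAt_coord_relocate hε hu.1 u.2 i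
  ((contDiffAt_pi.2 fun i => (hcoord i).fst).prodMk
    (contDiffAt_pi.2 fun i => (hcoord i).snd)).contDiffWithinAt

end Relocation

section Regularity

variable {N : ℕ} {K : Subgroup (Torus N)}

theorem exists_torusMoment_eq (d : Fin N → ℝ) :
    ∃ p : HN N, torusMoment p = d ∧ (∀ i, p.1 i * p.2 i = 0) ∧
      ∀ i, d i = 0 → p.1 i = 0 ∧ p.2 i = 0 := by
  refine ⟨(fun i => √(d i), fun i => √(-d i)), funext fun i => ?_, fun i => ?_, fun i hi => ?_⟩
  · rcases le_total 0 (d i) with h | h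
    · simp [torusMoment, coord, normSqSub, Real.sqrt_eq_zero_of_nonpos (neg_nonpos.2 h), h]
    · simp [torusMoment, coord, normSqSub, Real.sqrt_eq_zero_of_nonpos h, h]
  · rcases le_total 0 (d i) with h | h
    · simp [Real.sqrt_eq_zero_of_nonpos (neg_nonpos.2 h)]
    · simp [Real.sqrt_eq_zero_of_nonpos h]
  · simp [hi]

theorem hasFDerivAt_torusMoment_zero {p : HN N} {i : Fin N} (h1 : p.1 i = 0) (h2 : p.2 i = 0) :
    HasFDerivAt (fun q : HN N => torusMoment q i) (0 : HN N →L[ℝ] ℝ) p := by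
  let π : (Fin N → ℂ) →L[ℝ] ℂ := ContinuousLinearMap.proj i
  have hz : HasFDerivAt (fun q : HN N => q.1 i) (π ∘L .fst ℝ _ _) p :=
    (π.hasFDerivAt (x := p.1)).comp p hasFDerivAt_fst
  have hw : HasFDerivAt (fun q : HN N => q.2 i) (π ∘L .snd ℝ _ _) p :=
    (π.hasFDerivAt (x := p.2)).comp p hasFDerivAt_snd
  have h := hz.norm_sq.fun_sub hw.norm_sq
  simp only [h1, h2, map_zero, ContinuousLinearMap.zero_comp, smul_zero, sub_zero] at h
  exact h

theorem mu1_apply (p : HN N) (x : Lie K) :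
    mu1 K p x = Real.pi * ∑ i, torusMoment p i * iotaU K i x := by
  simp only [mu1_eq, smul_apply, sum_apply, smul_eq_mul]

theorem hasFDerivAt_mu1_apply_zero {p : HN N} {x : Lie K}
    (h : ∀ i, iotaU K i x ≠ 0 → p.1 i = 0 ∧ p.2 i = 0) :
    HasFDerivAt (fun q => mu1 K q x) (0 : HN N →L[ℝ] ℝ) p := by
  have hterm i : HasFDerivAt (fun q : HN N => torusMoment q i * iotaU K i x)
      (0 : HN N →L[ℝ] ℝ) p := by
    by_cases hi : iotaU K i x = 0
    · simpa [hi] using hasFDerivAt_const (0 : ℝ) p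
    · simpa using (hasFDerivAt_torusMoment_zero (h i hi).1 (h i hi).2).mul_const (iotaU K i x)
  simp only [mu1_apply]
  simpa using (HasFDerivAt.fun_sum fun i (_ : i ∈ Finset.univ) => hterm i).const_mul Real.pi

/-- If `x ≠ 0` were killed by all `ι^* u_i` with `d_i ≠ 0`, then `x` would be orthogonal to the
image of the differential of `μ` at a point of `μ⁻¹(α, 0)` all of whose other coordinates vanish. -/
theorem separates_of_mem_regularValues {α : kDual K}
    (hreg : (α, (0 : kDualC K)) ∈ regularValues K) {d : Fin N → ℝ}
    (hd : Real.pi • ∑ i, d i • iotaU K i = α) : Separates (iotaU K) {i | d i ≠ 0} := by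
  intro x hx
  by_contra hx0
  obtain ⟨p, rfl, hmul, hzero⟩ := exists_torusMoment_eq d
  have hmu : mu K p = (α, 0) := Prod.ext hd (by simp [mu, muC, hmul])
  obtain ⟨u, hu⟩ := SeparatingDual.exists_eq_one (R := ℝ) hx0
  obtain ⟨v, hv⟩ := hreg p hmu (u, 0)
  have hmu1 : HasFDerivAt (fun q => mu1 K q x)
      ((ContinuousLinearMap.apply ℝ ℝ x ∘L .fst ℝ _ _) ∘L fderiv ℝ (mu K) p) p :=
    (ContinuousLinearMap.apply ℝ ℝ x ∘L .fst ℝ (kDual K) (kDualC K)).hasFDerivAt.comp p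
      ((contDiff_mu K).differentiable (by simp) p).hasFDerivAt
  have hmu1_zero : HasFDerivAt (fun q => mu1 K q x) (0 : HN N →L[ℝ] ℝ) p :=
    hasFDerivAt_mu1_apply_zero fun i hi => hzero i (not_imp_comm.1 (hx i) hi)
  have hux : u x = 0 := by simpa [hv] using DFunLike.congr_fun (hmu1.unique hmu1_zero) v
  exact one_ne_zero (hu.symm.trans hux)

theorem exists_mu1Level_subset_separatingLocus {α : kDual K}
    (hreg : (α, (0 : kDualC K)) ∈ regularValues K) :
    ∃ ε > 0, mu1Level K α ⊆ separatingLocus K ε := by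
  have hα (d : Fin N → ℝ) : ∑ i, d i • iotaU K i = Real.pi⁻¹ • α ↔
      Real.pi • ∑ i, d i • iotaU K i = α :=
    eq_inv_smul_iff₀ Real.pi_ne_zero
  obtain ⟨ε, hε, h⟩ :=
    exists_pos_forall_separates fun d hd => separates_of_mem_regularValues hreg ((hα d).1 hd)
  exact ⟨ε, hε, fun p hp => h (torusMoment p) ((hα _).2 hp)⟩

end Regularity

section Quotient

theorem orbifoldSmooth_of_contDiffOn {E F : Type*} [NormedAddCommGroup E] [NormedSpace ℝ E]
    [NormedAddCommGroup F] [NormedSpace ℝ F] {A U : Set E} {B : Set F} {X Y : Type*}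
    {a : A → X} {b : B → Y} {f : X → Y} {s : E → F} (hs : ContDiffOn ℝ ∞ s U) (hU : IsOpen U)
    (hAU : A ⊆ U) (h : ∀ x : A, ∃ h : s x ∈ B, b ⟨s x, h⟩ = f (a x)) : OrbifoldSmooth a b f :=
  fun p => ⟨U, hU, hAU p.2, s, hs, fun x _ => h x⟩

/-- A homeomorphism `A ≃ B × C` matching an equivalence relation on `A` with one on `B` descends to
the quotients. -/
def quotientHomeomorphProd {A B C : Type*} [TopologicalSpace A] [TopologicalSpace B]
    [TopologicalSpace C] [LocallyCompactSpace C] (sA : Setoid A) (sB : Setoid B) (e : A ≃ₜ B × C)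
    (h : ∀ a a', sA a a' ↔ sB (e a).1 (e a').1 ∧ (e a).2 = (e a').2) :
    Quotient sA ≃ₜ Quotient sB × C where
  toFun := Quotient.lift (fun a => (Quotient.mk sB (e a).1, (e a).2)) fun a a' haa' =>
    Prod.ext (Quotient.sound ((h a a').1 haa').1) ((h a a').1 haa').2
  invFun x := Quotient.lift (fun b => Quotient.mk sA (e.symm (b, x.2))) (fun b b' hbb' =>
    Quotient.sound ((h _ _).2 (by simpa using hbb'))) x.1
  left_inv := by
    rintro ⟨a⟩
    exact congrArg (Quotient.mk sA) (e.symm_apply_apply a)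
  right_inv := by
    rintro ⟨⟨b⟩, c⟩
    have he := e.apply_symm_apply (b, c)
    exact Prod.ext (congrArg (Quotient.mk sB) (congrArg Prod.fst he)) (congrArg Prod.snd he :)
  continuous_toFun := Continuous.quotient_lift
    ((continuous_quotient_mk'.comp e.continuous.fst).prodMk e.continuous.snd) _
  continuous_invFun := (isQuotientMap_quotient_mk' (s := sB)).continuous_lift_prod_left
    (continuous_quotient_mk'.comp e.symm.continuous)

theorem nonempty_homotopyEquiv_prod_of_contractible (B C : Type*) [TopologicalSpace B]
    [TopologicalSpace C] [ContractibleSpace C] :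
    Nonempty (ContinuousMap.HomotopyEquiv B (B × C)) := by
  obtain ⟨e⟩ := ContractibleSpace.hequiv_unit C
  exact ⟨(Homeomorph.prodUnique B Unit).symm.toHomotopyEquiv.trans
    ((ContinuousMap.HomotopyEquiv.refl B).prodCongr e.symm)⟩

end Quotient

section Trivialization

variable {N : ℕ} {K : Subgroup (Torus N)} {ε : ℝ} {α : kDual K}

theorem hkLevel_subset_mu1Level (α : kDual K) (β : kDualC K) : hkLevel K α β ⊆ mu1Level K α :=
  fun _ h => congrArg Prod.fst h

theorem relocate_eq_self_of_mem_hkLevel {β : kDualC K} {p : HN N} (hp : p ∈ hkLevel K α β) :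
    relocate K ε p β = p :=
  have hmuC : muC K p = β := congrArg Prod.snd hp
  hmuC ▸ relocate_muC_self p

theorem relocate_mem_mu1Level {p : HN N} (hp : p ∈ mu1Level K α) (β : kDualC K) :
    relocate K ε p β ∈ mu1Level K α :=
  (mu1_relocate p β).trans hp

theorem relocate_mem_hkLevel (hε : 0 ≤ ε) (hα : mu1Level K α ⊆ separatingLocus K ε) {p : HN N}
    (hp : p ∈ mu1Level K α) (β : kDualC K) : relocate K ε p β ∈ hkLevel K α β :=
  Prod.ext (relocate_mem_mu1Level hp β) (muC_relocate hε (hα hp) β)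

theorem contDiffOn_relocate_prodMk_muC (hε : 0 < ε) (β : kDualC K) :
    ContDiffOn ℝ ∞ (fun p => (relocate K ε p β, muC K p)) (separatingLocus K ε) :=
  ((contDiffOn_relocate hε).comp (contDiffOn_id.prodMk contDiffOn_const)
    fun _ hp => ⟨hp, trivial⟩).prodMk (contDiff_muC K).contDiffOn

/-- The homeomorphism `μ₁⁻¹(α) ≃ μ⁻¹(α, β) × k_ℂ^*` which maps `p` to its relocation to
`μ_ℂ⁻¹(β)` and its original value of `μ_ℂ`. -/
noncomputable def mu1LevelHomeomorph (hε : 0 < ε) (hα : mu1Level K α ⊆ separatingLocus K ε)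
    (β : kDualC K) : mu1Level K α ≃ₜ hkLevel K α β × kDualC K where
  toFun p := (⟨relocate K ε p β, relocate_mem_hkLevel hε.le hα p.2 β⟩, muC K p)
  invFun x := ⟨relocate K ε x.1 x.2,
    relocate_mem_mu1Level (hkLevel_subset_mu1Level α β x.1.2) x.2⟩
  left_inv p := Subtype.ext ((relocate_relocate hε.le (hα p.2) _ _).trans (relocate_muC_self _))
  right_inv x := by
    have hx := hα (hkLevel_subset_mu1Level α β x.1.2)
    exact Prod.ext (Subtype.ext ((relocate_relocate hε.le hx _ _).trans
      (relocate_eq_self_of_mem_hkLevel x.1.2))) (muC_relocate hε.le hx _)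
  continuous_toFun := by
    have h : Continuous fun p : mu1Level K α => (relocate K ε p β, muC K p) :=
      continuousOn_iff_continuous_domRestrict.1
        ((contDiffOn_relocate_prodMk_muC hε β).continuousOn.mono hα)
    exact (h.fst.subtype_mk _).prodMk h.snd
  continuous_invFun :=
    ((contDiffOn_relocate hε).continuousOn.comp_continuous
      (continuous_subtype_val.fst'.prodMk continuous_snd)
      fun x => ⟨hα (hkLevel_subset_mu1Level α β x.1.2), trivial⟩).subtype_mk _

theorem orbit_iff_orbit_relocate (hε : 0 ≤ ε) {p q : HN N} (hp : p ∈ separatingLocus K ε)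
    (hq : q ∈ separatingLocus K ε) (β : kDualC K) :
    (∃ ζ ∈ K, act ζ p = q) ↔
      (∃ ζ ∈ K, act ζ (relocate K ε p β) = relocate K ε q β) ∧ muC K p = muC K q := by
  constructor
  · rintro ⟨ζ, hζ, rfl⟩
    exact ⟨⟨ζ, hζ, (relocate_act ζ p β).symm⟩, (muC_act K ζ p).symm⟩
  · rintro ⟨⟨ζ, hζ, h⟩, hmuC⟩
    refine ⟨ζ, hζ, ?_⟩
    calc act ζ p = act ζ (relocate K ε (relocate K ε p β) (muC K p)) := by
          rw [relocate_relocate hε hp, relocate_muC_self]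
      _ = relocate K ε (relocate K ε q β) (muC K q) := by rw [← relocate_act, h, hmuC]
      _ = q := by rw [relocate_relocate hε hq, relocate_muC_self]

/-- The homeomorphism `L(α) ≃ X(α, β) × k_ℂ^*` induced by `mu1LevelHomeomorph`. -/
noncomputable def quotientHomeomorph (hε : 0 < ε) (hα : mu1Level K α ⊆ separatingLocus K ε)
    (β : kDualC K) : L K α ≃ₜ X K α β × kDualC K :=
  quotientHomeomorphProd (orbitSetoid K (mu1Level K α)) (orbitSetoid K (hkLevel K α β))
    (mu1LevelHomeomorph hε hα β) fun p q =>
      orbit_iff_orbit_relocate hε.le (hα p.2) (hα q.2) β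

theorem orbifoldSmooth_quotientHomeomorph (hε : 0 < ε)
    (hα : mu1Level K α ⊆ separatingLocus K ε) (β : kDualC K) :
    OrbifoldSmooth (projL K α) (projXV K α β) (quotientHomeomorph hε hα β) :=
  orbifoldSmooth_of_contDiffOn (contDiffOn_relocate_prodMk_muC hε β) (isOpen_separatingLocus K ε)
    hα fun p => ⟨⟨relocate_mem_hkLevel hε.le hα p.2 β, trivial⟩, rfl⟩

theorem orbifoldSmooth_quotientHomeomorph_symm (hε : 0 < ε)
    (hα : mu1Level K α ⊆ separatingLocus K ε) (β : kDualC K) :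
    OrbifoldSmooth (projXV K α β) (projL K α) (quotientHomeomorph hε hα β).symm :=
  orbifoldSmooth_of_contDiffOn (contDiffOn_relocate hε)
    ((isOpen_separatingLocus K ε).prod isOpen_univ)
    (Set.prod_mono_left ((hkLevel_subset_mu1Level α β).trans hα))
    fun x => ⟨relocate_mem_mu1Level (hkLevel_subset_mu1Level α β x.2.1) _, rfl⟩

end Trivialization

end ToricHK

theorem mainTheorem7_general {N : ℕ} (K : Subgroup (ToricHK.Torus N)) (α : ToricHK.kDual K)
    (β : ToricHK.kDualC K) (hreg : (α, (0 : ToricHK.kDualC K)) ∈ ToricHK.regularValues K) :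
    ToricHK.OrbifoldDiffeomorphic (ToricHK.projL K α) (ToricHK.projXV K α β) ∧
      Nonempty (ContinuousMap.HomotopyEquiv (ToricHK.X K α β) (ToricHK.L K α)) := by
  obtain ⟨ε, hε, hα⟩ := ToricHK.exists_mu1Level_subset_separatingLocus hreg
  let Φ := ToricHK.quotientHomeomorph hε hα β
  obtain ⟨e⟩ := ToricHK.nonempty_homotopyEquiv_prod_of_contractible
    (ToricHK.X K α β) (ToricHK.kDualC K)
  exact ⟨⟨Φ, ToricHK.orbifoldSmooth_quotientHomeomorph hε hα β,
    ToricHK.orbifoldSmooth_quotientHomeomorph_symm hε hα β⟩, ⟨e.trans Φ.symm.toHomotopyEquiv⟩⟩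

theorem mainTheorem7 {N : ℕ} (K : Subgroup (ToricHK.Torus N))
    (hKclosed : IsClosed (K : Set (ToricHK.Torus N)))
    (hKconn : IsConnected (K : Set (ToricHK.Torus N)))
    (α : ToricHK.kDual K)
    (hreg : (α, (0 : ToricHK.kDualC K)) ∈ ToricHK.regularValues K) :
    ToricHK.OrbifoldDiffeomorphic (ToricHK.projL K α) (ToricHK.projXV K α 0) ∧
      Nonempty (ContinuousMap.HomotopyEquiv (ToricHK.X K α 0) (ToricHK.L K α)) :=
  mainTheorem7_general K α 0 hreg
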